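/- A simple stochastic game (SSG) $G$ is a finite directed graph whose vertex set $V$ is partitioned into max vertices, min vertices, random vertices and a non-empty set of sinks. Every non-sink vertex has at least one outgoing arc, and the only outgoing arc of a sink is a loop on itself. Each random vertex $x$ carries a rational probability distribution $p_x$ on $V$ with $p_x(y)>0$ if and only if $(x,y)$ is an arc, and each sink $s$ carries a rational value $\mathrm{Val}(s)\in[0,1]$. The game is not assumed to be stopping. A positional strategy of Max (resp. Min) chooses an outneighbour of every max (resp. min) vertex; a general strategy may depend on the whole history of the play. Given strategies $\sigma$ of Max and $\tau$ of Min and a starting vertex $x$, the random play follows $\sigma$ at max vertices, $\tau$ at min vertices and $p_y$ at each random vertex $y$; the value of a play is the value of the sink it reaches, and $0$ if it reaches no sink; and $v_{\sigma,\tau}(x)$ is the expected value of the play. A best response to a positional Max strategy $\sigma$ is a positional Min strategy $\tau$ with $v_{\sigma,\tau}\le v_{\sigma,\tau'}$ (at every vertex) for all general Min strategies $\tau'$. Such a $\tau$ exists, and $v_\sigma:=v_{\sigma,\tau}$ does not depend on which best response $\tau$ is taken. For positional Max strategies, write $\sigma'>\sigma$ (equivalently $\sigma<\sigma'$) if $v_{\sigma'}(x)\ge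 v_\sigma(x)$ for all vertices $x$ and $v_{\sigma'}(x)>v_\sigma(x)$ for some vertex $x$. Let $\sigma$ be a positional Max strategy, and let $S$ be a non-empty set of max vertices. A switch (resp. an anti-switch) of $\sigma$ with switched set $S$ is a positional Max strategy $\sigma_S$ such that $\sigma_S(x)=\sigma(x)$ for every max vertex $x\notin S$, and $v_\sigma(\sigma(x))<v_\sigma(\sigma_S(x))$ (resp. $v_\sigma(\sigma(x))>v_\sigma(\sigma_S(x))$) for every $x\in S$. Lemma. If $\sigma_S$ is a switch of $\sigma$, then $\sigma_S>\sigma$. If $\sigma_S$ is an anti-switch of $\sigma$, then $\sigma_S<\sigma$. -/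

import Mathlib

/-- The four kinds of vertices of a simple stochastic game. -/
inductive VertexKind where
  | max
  | min
  | random
  | sink
  deriving DecidableEq

/-- A simple stochastic game on a finite vertex set `V`: a directed graph `Arc` whose vertices are
partitioned by `kind`.  The numbers `prob x y` matter only for random `x`, and `val x` only for
sinks `x`. -/
structure SSG (V : Type*) [Fintype V] where
  kind : V → VertexKind
  Arc : V → V → Prop
  prob : V → V → ℚ
  val : V → ℚ
  exists_sink : ∃ s, kind s = .sink
  exists_arc : ∀ x, kind x ≠ .sink → ∃ y, Arc x y
  sink_arc_iff : ∀ x, kind x = .sink → ∀ y, Arc x y ↔ y = x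
  prob_nonneg : ∀ x, kind x = .random → ∀ y, 0 ≤ prob x y
  prob_sum : ∀ x, kind x = .random → ∑ y, prob x y = 1
  prob_pos_iff : ∀ x, kind x = .random → ∀ y, 0 < prob x y ↔ Arc x y
  val_nonneg : ∀ x, kind x = .sink → 0 ≤ val x
  val_le_one : ∀ x, kind x = .sink → val x ≤ 1

namespace SSG

section

open MeasureTheory ProbabilityTheory Finset Filter Topology Preorder

variable {V : Type*} [Fintype V]

/-- The last vertex of a finite sequence `(x₀, …, xₙ)`. -/
def lastVertex {n : ℕ} (h : Iic n → V) : V := h ⟨n, by simp⟩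

/-- A general (history dependent) strategy of the player owning the vertices of kind `k`: after
`(x₀, …, xₙ)` with `xₙ` of kind `k` it chooses an outneighbour of `xₙ`.  (Its choices after
sequences that are not paths of the game are never used.) -/
def GeneralStrategy (G : SSG V) (k : VertexKind) : Type _ :=
  (n : ℕ) → (h : Iic n → V) → G.kind (lastVertex h) = k → {y : V // G.Arc (lastVertex h) y}

/-- A positional strategy of the player owning the vertices of kind `k`. -/
def PositionalStrategy (G : SSG V) (k : VertexKind) : Type _ :=
  (x : {x : V // G.kind x = k}) → {y : V // G.Arc x y}

/-- A positional strategy, viewed as a general one. -/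
def PositionalStrategy.toGeneral {G : SSG V} {k : VertexKind} (σ : G.PositionalStrategy k) :
    G.GeneralStrategy k :=
  fun _ h hk => σ ⟨lastVertex h, hk⟩

/-- The value of a play: the value of the sink that it reaches, and `0` if it reaches no sink. -/
noncomputable def playValue (G : SSG V) (X : ℕ → V) : ℝ :=
  open Classical in
  if h : ∃ t, G.kind (X t) = .sink then (G.val (X (Nat.find h)) : ℝ) else 0

variable [MeasurableSpace V]

/-- The distribution of the next vertex after `(x₀, …, xₙ)` when the players use `σ` and `τ`. -/
noncomputable def nextMeasure (G : SSG V) (σ : G.GeneralStrategy .max)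
    (τ : G.GeneralStrategy .min) (n : ℕ) (h : Iic n → V) : Measure V :=
  if hmax : G.kind (lastVertex h) = .max then Measure.dirac (σ n h hmax : V)
  else if hmin : G.kind (lastVertex h) = .min then Measure.dirac (τ n h hmin : V)
  else if G.kind (lastVertex h) = .random then
    ∑ y, ENNReal.ofReal (G.prob (lastVertex h) y : ℝ) • Measure.dirac y
  else Measure.dirac (lastVertex h)

instance (G : SSG V) (σ : G.GeneralStrategy .max) (τ : G.GeneralStrategy .min) (n : ℕ)
    (h : Iic n → V) : IsProbabilityMeasure (G.nextMeasure σ τ n h) := by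
  unfold nextMeasure
  split_ifs with h1 h2 h3
  · infer_instance
  · infer_instance
  · constructor
    simp only [Measure.coe_finsetSum, Measure.coe_smul, Finset.sum_apply, Pi.smul_apply,
      measure_univ, smul_eq_mul, mul_one]
    rw [← ENNReal.ofReal_sum_of_nonneg]
    · rw [← Rat.cast_sum, G.prob_sum _ h3]; simp
    · intro y _
      exact_mod_cast G.prob_nonneg _ h3 y
  · infer_instance

variable [DiscreteMeasurableSpace V]

/-- `nextMeasure` as a transition kernel. -/
noncomputable def nextKernel (G : SSG V) (σ : G.GeneralStrategy .max)
    (τ : G.GeneralStrategy .min) (n : ℕ) : Kernel (Iic n → V) V :=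
  Kernel.ofFunOfCountable (G.nextMeasure σ τ n)

instance (G : SSG V) (σ : G.GeneralStrategy .max) (τ : G.GeneralStrategy .min) (n : ℕ) :
    IsMarkovKernel (G.nextKernel σ τ n) :=
  ⟨fun h => inferInstanceAs (IsProbabilityMeasure (G.nextMeasure σ τ n h))⟩

/-- The law of the random play that starts at `x₀` when the players use `σ` and `τ`. -/
noncomputable def playMeasure (G : SSG V) (σ : G.GeneralStrategy .max)
    (τ : G.GeneralStrategy .min) (x₀ : V) : Measure (ℕ → V) :=
  Kernel.traj (X := fun _ => V) (G.nextKernel σ τ) 0 (fun _ => x₀)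

instance (G : SSG V) (σ : G.GeneralStrategy .max) (τ : G.GeneralStrategy .min) (x₀ : V) :
    IsProbabilityMeasure (G.playMeasure σ τ x₀) := by
  unfold playMeasure; infer_instance

/-- The value vector `v_{σ,τ}`: the expected value of the play. -/
noncomputable def value (G : SSG V) (σ : G.GeneralStrategy .max)
    (τ : G.GeneralStrategy .min) (x₀ : V) : ℝ :=
  ∫ X, G.playValue X ∂(G.playMeasure σ τ x₀)

/-- The positional Min strategy `τ` is a best response to the positional Max strategy `σ`, against
all (general) Min strategies; `≤` is the pointwise order of vectors. -/
def IsBestResponse (G : SSG V) (σ : G.PositionalStrategy .max) (τ : G.PositionalStrategy .min) :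
    Prop :=
  ∀ τ' : G.GeneralStrategy .min, G.value σ.toGeneral τ.toGeneral ≤ G.value σ.toGeneral τ'

/-! Existence of positional best responses. -/


lemma integrable_comp_eval (G : SSG V) (σ : G.GeneralStrategy .max) (τ : G.GeneralStrategy .min)
    (x₀ : V) (f : V → ℝ) (n : ℕ) : Integrable (fun X => f (X n)) (G.playMeasure σ τ x₀) := by
  have : Measurable f := measurable_of_finite f
  obtain ⟨C, hC⟩ := (Set.finite_range fun x => ‖f x‖).bddAbove
  exact Integrable.of_bound (this.comp (measurable_pi_apply n)).aestronglyMeasurable C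
    (ae_of_all _ fun X => hC ⟨X n, rfl⟩)

/-- The Markov-type property of the play. -/
lemma integral_next (G : SSG V) (σ : G.GeneralStrategy .max) (τ : G.GeneralStrategy .min)
    (x₀ : V) (n : ℕ) (F : (Iic n → V) × V → ℝ) :
    ∫ X, F (frestrictLe (π := fun _ => V) n X, X (n + 1)) ∂(G.playMeasure σ τ x₀) =
      ∫ X, (∫ y, F (frestrictLe (π := fun _ => V) n X, y)
        ∂(G.nextMeasure σ τ n (frestrictLe (π := fun _ => V) n X))) ∂(G.playMeasure σ τ x₀) := by
  have hF : Measurable F := measurable_of_finite F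
  have key := Kernel.partialTraj_compProd_eq_map_traj (X := fun _ => V)
    (κ := G.nextKernel σ τ) (Nat.zero_le n) (x₀ := fun _ => x₀)
  unfold playMeasure
  have h1 : ∫ X, F (frestrictLe (π := fun _ => V) n X, X (n + 1))
      ∂(Kernel.traj (X := fun _ => V) (G.nextKernel σ τ) 0 (fun _ => x₀)) =
      ∫ p, F p ∂((Kernel.traj (X := fun _ => V) (G.nextKernel σ τ) 0 (fun _ => x₀)).map
        (fun X => (frestrictLe (π := fun _ => V) n X, X (n + 1)))) := by
    rw [integral_map (by fun_prop) hF.aestronglyMeasurable]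
  rw [h1, ← key, Measure.integral_compProd]
  · rw [← Kernel.traj_map_frestrictLe_apply, integral_map (by fun_prop)]
    · rfl
    · exact (measurable_of_finite _).aestronglyMeasurable
  · obtain ⟨C, hC⟩ := (Set.finite_range fun x => ‖F x‖).bddAbove
    exact Integrable.of_bound hF.aestronglyMeasurable C (ae_of_all _ fun X => hC ⟨X, rfl⟩)

lemma integral_eval_zero (G : SSG V) (σ : G.GeneralStrategy .max) (τ : G.GeneralStrategy .min)
    (x₀ : V) (f : V → ℝ) : ∫ X, f (X 0) ∂(G.playMeasure σ τ x₀) = f x₀ := by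
  have hf : Measurable f := measurable_of_finite f
  have h1 : ∫ X, f (X 0) ∂(G.playMeasure σ τ x₀) =
      ∫ h, f (h ⟨0, by simp⟩) ∂((G.playMeasure σ τ x₀).map (frestrictLe (π := fun _ => V) 0)) := by
    rw [integral_map (by fun_prop) (measurable_of_finite _).aestronglyMeasurable]
    rfl
  rw [h1, playMeasure, Kernel.traj_map_frestrictLe_apply, Kernel.partialTraj_self, Kernel.id_apply,
    integral_dirac]

lemma integral_nextMeasure_max (G : SSG V) (σ : G.GeneralStrategy .max)
    (τ : G.GeneralStrategy .min) {n : ℕ} (h : Iic n → V) (f : V → ℝ)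
    (hk : G.kind (lastVertex h) = .max) :
    ∫ y, f y ∂(G.nextMeasure σ τ n h) = f (σ n h hk) := by
  simp [nextMeasure, hk]

lemma integral_nextMeasure_min (G : SSG V) (σ : G.GeneralStrategy .max)
    (τ : G.GeneralStrategy .min) {n : ℕ} (h : Iic n → V) (f : V → ℝ)
    (hk : G.kind (lastVertex h) = .min) :
    ∫ y, f y ∂(G.nextMeasure σ τ n h) = f (τ n h hk) := by
  simp [nextMeasure, hk]

lemma integral_nextMeasure_random (G : SSG V) (σ : G.GeneralStrategy .max)
    (τ : G.GeneralStrategy .min) {n : ℕ} (h : Iic n → V) (f : V → ℝ)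
    (hk : G.kind (lastVertex h) = .random) :
    ∫ y, f y ∂(G.nextMeasure σ τ n h) = ∑ y, (G.prob (lastVertex h) y : ℝ) * f y := by
  have hm : G.nextMeasure σ τ n h =
      ∑ y, ENNReal.ofReal (G.prob (lastVertex h) y : ℝ) • Measure.dirac y := by
    simp [nextMeasure, hk]
  rw [hm, integral_finsetSum_measure]
  · refine Finset.sum_congr rfl fun y _ => ?_
    have : (0 : ℝ) ≤ (G.prob (lastVertex h) y : ℝ) := by exact_mod_cast G.prob_nonneg _ hk y
    rw [integral_smul_measure, integral_dirac, ENNReal.toReal_ofReal this, smul_eq_mul]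
  · intro y _
    exact (integrable_dirac (by simp)).smul_measure (by simp)

lemma integral_nextMeasure_sink (G : SSG V) (σ : G.GeneralStrategy .max)
    (τ : G.GeneralStrategy .min) {n : ℕ} (h : Iic n → V) (f : V → ℝ)
    (hk : G.kind (lastVertex h) = .sink) :
    ∫ y, f y ∂(G.nextMeasure σ τ n h) = f (lastVertex h) := by
  simp [nextMeasure, hk]

/-- The amount already won at a vertex: its value if it is a sink, else `0`. -/
noncomputable def sinkValue (G : SSG V) (x : V) : ℝ := if G.kind x = .sink then (G.val x : ℝ) else 0

lemma integral_eval_mono (G : SSG V) (σ : G.GeneralStrategy .max) (τ : G.GeneralStrategy .min)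
    (x₀ : V) (n : ℕ) (a b : V → ℝ)
    (hab : ∀ h : Iic n → V, a (lastVertex h) ≤ ∫ y, b y ∂(G.nextMeasure σ τ n h)) :
    ∫ X, a (X n) ∂(G.playMeasure σ τ x₀) ≤ ∫ X, b (X (n + 1)) ∂(G.playMeasure σ τ x₀) := by
  rw [G.integral_next σ τ x₀ n (fun p => b p.2)]
  refine integral_mono (G.integrable_comp_eval σ τ x₀ a n) ?_ fun X =>
    hab (frestrictLe (π := fun _ => V) n X)
  have hm : Measurable fun h : Iic n → V => ∫ y, b y ∂(G.nextMeasure σ τ n h) :=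
    measurable_of_finite _
  obtain ⟨C, hC⟩ := (Set.finite_range fun h : Iic n → V =>
    ‖∫ y, b y ∂(G.nextMeasure σ τ n h)‖).bddAbove
  exact Integrable.of_bound (hm.comp (measurable_frestrictLe n)).aestronglyMeasurable C
    (ae_of_all _ fun X => hC ⟨_, rfl⟩)

/-- Almost surely, a play that is in a sink stays there. -/
lemma ae_sink_stays (G : SSG V) (σ : G.GeneralStrategy .max) (τ : G.GeneralStrategy .min)
    (x₀ : V) : ∀ᵐ X ∂(G.playMeasure σ τ x₀), ∀ n, G.kind (X n) = .sink → X (n + 1) = X n := by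
  classical
  rw [ae_all_iff]
  intro n
  let F : (Iic n → V) × V → ℝ := fun p =>
    if G.kind (lastVertex p.1) = .sink ∧ p.2 ≠ lastVertex p.1 then 1 else 0
  have h0 : ∫ X, F (frestrictLe (π := fun _ => V) n X, X (n + 1)) ∂(G.playMeasure σ τ x₀) = 0 := by
    rw [G.integral_next]
    refine integral_eq_zero_of_ae (ae_of_all _ fun X => ?_)
    by_cases hk : G.kind (lastVertex (frestrictLe (π := fun _ => V) n X)) = .sink
    · simp only [Pi.zero_apply]
      rw [G.integral_nextMeasure_sink σ τ _ (fun y => F (_, y)) hk]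
      simp [F]
    · simp [F, hk]
  have hF : Measurable F := measurable_of_finite F
  rw [integral_eq_zero_iff_of_nonneg] at h0
  · filter_upwards [h0] with X hX hk
    by_contra hne
    have : F (frestrictLe (π := fun _ => V) n X, X (n + 1)) = 1 := if_pos ⟨hk, hne⟩
    simp [this] at hX
  · intro X
    simp only [F, Pi.zero_apply]
    split_ifs <;> simp
  · refine Integrable.of_bound (hF.comp ((measurable_frestrictLe n).prodMk
      (measurable_pi_apply (n + 1)))).aestronglyMeasurable 1 (ae_of_all _ fun X => ?_)
    simp only [F]
    split_ifs <;> simp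

/-- The value is the limit of the expected gain after `n` moves. -/
lemma tendsto_value (G : SSG V) (σ : G.GeneralStrategy .max) (τ : G.GeneralStrategy .min)
    (x₀ : V) : Tendsto (fun n => ∫ X, G.sinkValue (X n) ∂(G.playMeasure σ τ x₀)) atTop
      (𝓝 (G.value σ τ x₀)) := by
  classical
  obtain ⟨C, hC⟩ := (Set.finite_range fun x => ‖G.sinkValue x‖).bddAbove
  refine tendsto_integral_of_dominated_convergence (fun _ => C)
    (fun n => (G.integrable_comp_eval σ τ x₀ _ n).1) (integrable_const _)
    (fun n => ae_of_all _ fun X => hC ⟨X n, rfl⟩) ?_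
  filter_upwards [G.ae_sink_stays σ τ x₀] with X hX
  by_cases h : ∃ t, G.kind (X t) = .sink
  · have hs : ∀ m, X (Nat.find h + m) = X (Nat.find h) := by
      intro m
      induction m with
      | zero => rfl
      | succ m ih => rw [← add_assoc, hX _ (by rw [ih]; exact Nat.find_spec h), ih]
    refine tendsto_const_nhds.congr' ?_
    filter_upwards [eventually_ge_atTop (Nat.find h)] with n hn
    obtain ⟨m, rfl⟩ := Nat.exists_eq_add_of_le hn
    rw [hs m, sinkValue, if_pos (Nat.find_spec h), playValue, dif_pos h]
  · have : G.playValue X = 0 := by rw [playValue, dif_neg h]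
    rw [this]
    push Not at h
    simp [sinkValue, h]

/-- The least expected gain of Max after at most `n` moves, when Max uses `σ`. -/
noncomputable def minGain (G : SSG V) (σ : G.PositionalStrategy .max) : ℕ → V → ℝ
  | 0, x => G.sinkValue x
  | n + 1, x =>
    if hmax : G.kind x = .max then minGain G σ n (σ ⟨x, hmax⟩)
    else if G.kind x = .min then ⨅ y : {y : V // G.Arc x y}, minGain G σ n y
    else if G.kind x = .random then ∑ y, (G.prob x y : ℝ) * minGain G σ n y
    else (G.val x : ℝ)

theorem exists_isBestResponse (G : SSG V) (σ : G.PositionalStrategy .max) :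
    ∃ τ : G.PositionalStrategy .min, G.IsBestResponse σ τ := by
  classical
  have hne : ∀ x, G.kind x = .min → Nonempty {y : V // G.Arc x y} := fun x hx => by
    obtain ⟨y, hy⟩ := G.exists_arc x (by simp [hx])
    exact ⟨⟨y, hy⟩⟩
  have hbb : ∀ n x, BddBelow (Set.range fun y : {y : V // G.Arc x y} => G.minGain σ n y) :=
    fun n x => (Set.finite_range _).bddBelow
  have hcases : ∀ x, G.kind x = .max ∨ G.kind x = .min ∨ G.kind x = .random ∨ G.kind x = .sink :=
    fun x => by cases G.kind x <;> simp
  have e_max : ∀ n x (hx : G.kind x = .max), G.minGain σ (n + 1) x = G.minGain σ n (σ ⟨x, hx⟩) :=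
    fun n x hx => by simp [minGain, hx]
  have e_min : ∀ n x, G.kind x = .min →
      G.minGain σ (n + 1) x = ⨅ y : {y : V // G.Arc x y}, G.minGain σ n y :=
    fun n x hx => by simp [minGain, hx]
  have e_ran : ∀ n x, G.kind x = .random →
      G.minGain σ (n + 1) x = ∑ y, (G.prob x y : ℝ) * G.minGain σ n y :=
    fun n x hx => by simp [minGain, hx]
  have e_snk : ∀ n x, G.kind x = .sink → G.minGain σ n x = G.val x := fun n x hx => by
    cases n <;> simp [minGain, sinkValue, hx]
  have hp : ∀ x, G.kind x = .random → ∀ y, (0 : ℝ) ≤ G.prob x y := fun x hx y => by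
    exact_mod_cast G.prob_nonneg x hx y
  have hp1 : ∀ x, G.kind x = .random → ∑ y, (G.prob x y : ℝ) = 1 := fun x hx => by
    exact_mod_cast G.prob_sum x hx
  have hb : ∀ n x, 0 ≤ G.minGain σ n x ∧ G.minGain σ n x ≤ 1 := by
    intro n
    induction n with
    | zero =>
      intro x
      simp only [minGain, sinkValue]
      split_ifs with hx
      · exact ⟨by exact_mod_cast G.val_nonneg x hx, by exact_mod_cast G.val_le_one x hx⟩
      · simp
    | succ n ih =>
      intro x
      rcases hcases x with hx | hx | hx | hx
      · rw [e_max n x hx]; exact ih _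
      · rw [e_min n x hx]
        have := hne x hx
        exact ⟨le_ciInf fun y => (ih y).1,
          (ciInf_le (hbb n x) (Classical.arbitrary _)).trans (ih _).2⟩
      · rw [e_ran n x hx]
        refine ⟨Finset.sum_nonneg fun y _ => mul_nonneg (hp x hx y) (ih y).1, ?_⟩
        rw [← hp1 x hx]
        exact Finset.sum_le_sum fun y _ => mul_le_of_le_one_right (hp x hx y) (ih y).2
      · rw [e_snk _ x hx]
        exact ⟨by exact_mod_cast G.val_nonneg x hx, by exact_mod_cast G.val_le_one x hx⟩
  have hmono1 : ∀ n x, G.minGain σ n x ≤ G.minGain σ (n + 1) x := by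
    intro n
    induction n with
    | zero =>
      intro x
      by_cases hx : G.kind x = .sink
      · rw [e_snk _ x hx, e_snk _ x hx]
      · have : G.minGain σ 0 x = 0 := by simp [minGain, sinkValue, hx]
        rw [this]; exact (hb 1 x).1
    | succ n ih =>
      intro x
      rcases hcases x with hx | hx | hx | hx
      · rw [e_max _ x hx, e_max _ x hx]; exact ih _
      · rw [e_min _ x hx, e_min _ x hx]
        exact ciInf_mono (hbb n x) fun y => ih y
      · rw [e_ran _ x hx, e_ran _ x hx]
        exact Finset.sum_le_sum fun y _ => mul_le_mul_of_nonneg_left (ih y) (hp x hx y)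
      · rw [e_snk _ x hx, e_snk _ x hx]
  have hmono : ∀ x, Monotone fun n => G.minGain σ n x := fun x =>
    monotone_nat_of_le_succ fun n => hmono1 n x
  have hbdd : ∀ x, BddAbove (Set.range fun n => G.minGain σ n x) := fun x =>
    ⟨1, by rintro _ ⟨n, rfl⟩; exact (hb n x).2⟩
  let w : V → ℝ := fun x => ⨆ n, G.minGain σ n x
  have hw : ∀ x, Tendsto (fun n => G.minGain σ n x) atTop (𝓝 (w x)) := fun x =>
    tendsto_atTop_ciSup (hmono x) (hbdd x)
  have hw_le : ∀ n x, G.minGain σ n x ≤ w x := fun n x => le_ciSup (hbdd x) n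
  have hmin : ∀ x : {x : V // G.kind x = .min}, ∃ y : {y : V // G.Arc x y}, w y ≤ w x := by
    rintro ⟨x, hx⟩
    by_contra! hlt
    have hev : ∀ᶠ n in atTop, ∀ y : {y : V // G.Arc x y}, w x < G.minGain σ n y :=
      eventually_all.2 fun y => (hw y).eventually_const_lt (hlt y)
    obtain ⟨n, hn⟩ := hev.exists
    have := hne x hx
    obtain ⟨y, hy⟩ := exists_eq_ciInf_of_finite (f := fun y : {y : V // G.Arc x y} =>
      G.minGain σ n y)
    have h1 := hw_le (n + 1) x
    rw [e_min n x hx, ← hy] at h1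
    exact absurd (hn y) (not_lt.2 h1)
  choose τ hτ using hmin
  refine ⟨τ, fun τ' x₀ => le_trans (b := w x₀) ?_ ?_⟩
  · -- Following `τ`, the expectation of `w` does not increase.
    have hstep : ∀ n, ∫ X, w (X n) ∂(G.playMeasure σ.toGeneral (PositionalStrategy.toGeneral τ) x₀)
        ≤ w x₀ := by
      intro n
      induction n with
      | zero => rw [G.integral_eval_zero]
      | succ n ih =>
        refine le_trans ?_ ih
        have := G.integral_eval_mono σ.toGeneral (PositionalStrategy.toGeneral τ) x₀ n
          (fun x => - w x) (fun x => - w x) fun h => ?_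
        · simpa [integral_neg] using this
        · rw [integral_neg, neg_le_neg_iff]
          rcases hcases (lastVertex h) with hx | hx | hx | hx
          · rw [G.integral_nextMeasure_max _ _ h w hx]
            refine le_of_tendsto (hw _) (Eventually.of_forall fun n => ?_)
            have := hw_le (n + 1) (lastVertex h)
            rwa [e_max n _ hx] at this
          · rw [G.integral_nextMeasure_min _ _ h w hx]
            exact hτ ⟨_, hx⟩
          · rw [G.integral_nextMeasure_random _ _ h w hx]
            refine le_of_tendsto (tendsto_finsetSum _ fun y _ => (hw y).const_mul _)
              (Eventually.of_forall fun n => ?_)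
            have := hw_le (n + 1) (lastVertex h)
            rwa [e_ran n _ hx] at this
          · rw [G.integral_nextMeasure_sink _ _ h w hx]
    refine le_of_tendsto (G.tendsto_value _ _ x₀) (Eventually.of_forall fun n => ?_)
    refine le_trans ?_ (hstep n)
    exact integral_mono (G.integrable_comp_eval _ _ x₀ _ n) (G.integrable_comp_eval _ _ x₀ _ n)
      fun X => hw_le 0 (X n)
  · refine le_of_tendsto_of_tendsto' (hw x₀) (G.tendsto_value σ.toGeneral τ' x₀) fun n => ?_
    have hstep : ∀ m k, m + k = n → G.minGain σ n x₀ ≤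
        ∫ X, G.minGain σ k (X m) ∂(G.playMeasure σ.toGeneral τ' x₀) := by
      intro m
      induction m with
      | zero =>
        intro k hk
        rw [G.integral_eval_zero, ← hk, zero_add]
      | succ m ih =>
        intro k hk
        refine (ih (k + 1) (by omega)).trans (G.integral_eval_mono _ _ x₀ m _ _ fun h => ?_)
        rcases hcases (lastVertex h) with hx | hx | hx | hx
        · rw [G.integral_nextMeasure_max _ _ h _ hx, e_max k _ hx]; rfl
        · rw [G.integral_nextMeasure_min _ _ h _ hx, e_min k _ hx]
          exact ciInf_le (hbb k _) (τ' m h hx)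
        · rw [G.integral_nextMeasure_random _ _ h _ hx, e_ran k _ hx]
        · rw [G.integral_nextMeasure_sink _ _ h _ hx, e_snk _ _ hx, e_snk _ _ hx]
    exact hstep n 0 rfl

/-- `v_σ`: the value vector of `σ` against a best response. -/
noncomputable def stratValue (G : SSG V) (σ : G.PositionalStrategy .max) : V → ℝ :=
  G.value σ.toGeneral (G.exists_isBestResponse σ).choose.toGeneral

/-- `v_σ` does not depend on the choice of the best response. -/
theorem stratValue_eq (G : SSG V) (σ : G.PositionalStrategy .max) (τ : G.PositionalStrategy .min)
    (hτ : G.IsBestResponse σ τ) : G.stratValue σ = G.value σ.toGeneral τ.toGeneral :=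
  le_antisymm ((G.exists_isBestResponse σ).choose_spec _) (hτ _)

/-- `σ' > σ`: the value vector of `σ'` is at least that of `σ` at every vertex and larger at some
vertex. -/
def StrictlyBetter (G : SSG V) (σ' σ : G.PositionalStrategy .max) : Prop :=
  (∀ x, G.stratValue σ x ≤ G.stratValue σ' x) ∧ ∃ x, G.stratValue σ x < G.stratValue σ' x

/-- `σ'` is a switch of `σ` with switched set `S`. -/
def IsSwitch (G : SSG V) (σ σ' : G.PositionalStrategy .max)
    (S : Set {x : V // G.kind x = .max}) : Prop :=
  (∀ x ∉ S, σ' x = σ x) ∧ ∀ x ∈ S, G.stratValue σ (σ x) < G.stratValue σ (σ' x)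

/-- `σ'` is an anti-switch of `σ` with switched set `S`. -/
def IsAntiSwitch (G : SSG V) (σ σ' : G.PositionalStrategy .max)
    (S : Set {x : V // G.kind x = .max}) : Prop :=
  (∀ x ∉ S, σ' x = σ x) ∧ ∀ x ∈ S, G.stratValue σ (σ' x) < G.stratValue σ (σ x)

end

end SSG

namespace SSG

section

open MeasureTheory ProbabilityTheory Finset Filter Topology Preorder

variable {V : Type*} [Fintype V]

/-! The gains `minGain σ n` increase with `n` to `v_σ` (`tendsto_minGain`). Passing to the limit in
their recursion gives the local equations of `v_σ`: equality along `σ` at max vertices, the mean at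
random vertices, the least outneighbour at min vertices. The limit also selects the right solution,
since the equations alone can have several when the game is not stopping.

Anti-switch: `v_σ` is superharmonic for `σ'`, because moving along `σ'` at a switched vertex lowers
it. Being nonnegative, it bounds `v_σ'` from above (`stratValue_le_of_superharmonic`).

Switch: the mirrored argument fails, since plays that never stop pay 0 although `v_σ` may stay
positive along them. A maximum principle replaces it. If `d = v_σ - v_σ'` had a positive maximum,
its argmax `C` would contain no sink and no switched vertex, so `σ` and `σ'` agree on it, and Min
could confine the play to `C` against `σ`. Then `v_σ = 0` on `C` (`stratValue_le_zero_of_trap`), so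
`d ≤ 0` there, a contradiction.

Strictness appears at every switched vertex, by one step of the local equations. -/

lemma kind_cases (G : SSG V) (x : V) :
    G.kind x = .max ∨ G.kind x = .min ∨ G.kind x = .random ∨ G.kind x = .sink := by
  cases G.kind x <;> simp

lemma prob_cast_nonneg (G : SSG V) {x : V} (hx : G.kind x = .random) (y : V) :
    (0 : ℝ) ≤ G.prob x y := by
  exact_mod_cast G.prob_nonneg x hx y

lemma prob_cast_sum (G : SSG V) {x : V} (hx : G.kind x = .random) :
    ∑ y, (G.prob x y : ℝ) = 1 := by
  exact_mod_cast G.prob_sum x hx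

lemma nonempty_arc (G : SSG V) {x : V} (hx : G.kind x = .min) : Nonempty {y : V // G.Arc x y} := by
  obtain ⟨y, hy⟩ := G.exists_arc x (by simp [hx])
  exact ⟨⟨y, hy⟩⟩

/-! ### Finite-horizon gains: recursion and monotonicity. -/

lemma minGain_max (G : SSG V) (σ : G.PositionalStrategy .max) (n : ℕ) {x : V}
    (hx : G.kind x = .max) : G.minGain σ (n + 1) x = G.minGain σ n (σ ⟨x, hx⟩) := by
  simp [minGain, hx]

lemma minGain_min (G : SSG V) (σ : G.PositionalStrategy .max) (n : ℕ) {x : V}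
    (hx : G.kind x = .min) :
    G.minGain σ (n + 1) x = ⨅ y : {y : V // G.Arc x y}, G.minGain σ n y := by
  simp [minGain, hx]

lemma minGain_random (G : SSG V) (σ : G.PositionalStrategy .max) (n : ℕ) {x : V}
    (hx : G.kind x = .random) :
    G.minGain σ (n + 1) x = ∑ y, (G.prob x y : ℝ) * G.minGain σ n y := by
  simp [minGain, hx]

lemma minGain_sink (G : SSG V) (σ : G.PositionalStrategy .max) (n : ℕ) {x : V}
    (hx : G.kind x = .sink) : G.minGain σ n x = G.val x := by
  cases n <;> simp [minGain, sinkValue, hx]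

lemma bddBelow_minGain (G : SSG V) (σ : G.PositionalStrategy .max) (n : ℕ) (x : V) :
    BddBelow (Set.range fun y : {y : V // G.Arc x y} => G.minGain σ n y) :=
  (Set.finite_range _).bddBelow

lemma minGain_succ_le (G : SSG V) (σ : G.PositionalStrategy .max) (n : ℕ) {x y : V}
    (hx : G.kind x = .min) (hy : G.Arc x y) : G.minGain σ (n + 1) x ≤ G.minGain σ n y := by
  rw [minGain_min G σ n hx]
  exact ciInf_le (bddBelow_minGain G σ n x) ⟨y, hy⟩

lemma minGain_nonneg (G : SSG V) (σ : G.PositionalStrategy .max) (n : ℕ) (x : V) :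
    0 ≤ G.minGain σ n x := by
  induction n generalizing x with
  | zero =>
    simp only [minGain, sinkValue]
    split_ifs with hx
    · exact_mod_cast G.val_nonneg x hx
    · rfl
  | succ n ih =>
    rcases G.kind_cases x with hx | hx | hx | hx
    · rw [minGain_max G σ n hx]; exact ih _
    · rw [minGain_min G σ n hx]
      exact Real.iInf_nonneg fun y => ih y
    · rw [minGain_random G σ n hx]
      exact Finset.sum_nonneg fun y _ => mul_nonneg (G.prob_cast_nonneg hx y) (ih y)
    · rw [minGain_sink G σ _ hx]; exact_mod_cast G.val_nonneg x hx

lemma monotone_minGain (G : SSG V) (σ : G.PositionalStrategy .max) (x : V) :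
    Monotone fun n => G.minGain σ n x := by
  refine monotone_nat_of_le_succ fun n => ?_
  induction n generalizing x with
  | zero =>
    by_cases hx : G.kind x = .sink
    · rw [minGain_sink G σ _ hx, minGain_sink G σ _ hx]
    · have : G.minGain σ 0 x = 0 := by simp [minGain, sinkValue, hx]
      rw [this]; exact minGain_nonneg G σ _ x
  | succ n ih =>
    rcases G.kind_cases x with hx | hx | hx | hx
    · rw [minGain_max G σ _ hx, minGain_max G σ _ hx]; exact ih _
    · rw [minGain_min G σ _ hx, minGain_min G σ _ hx]
      exact ciInf_mono (bddBelow_minGain G σ n x) fun y => ih y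
    · rw [minGain_random G σ _ hx, minGain_random G σ _ hx]
      exact Finset.sum_le_sum fun y _ => mul_le_mul_of_nonneg_left (ih y) (G.prob_cast_nonneg hx y)
    · rw [minGain_sink G σ _ hx, minGain_sink G σ _ hx]

/-- If the gains converge, then at a min vertex some outneighbour has a limit that is not larger. -/
lemma exists_arc_le_of_tendsto_minGain (G : SSG V) (σ : G.PositionalStrategy .max) {w : V → ℝ}
    (hw : ∀ x, Tendsto (fun n => G.minGain σ n x) atTop (𝓝 (w x))) {x : V}
    (hx : G.kind x = .min) : ∃ y, G.Arc x y ∧ w y ≤ w x := by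
  by_contra! hlt
  -- There are finitely many outneighbours, so one horizon `n` serves for all of them; the gain of
  -- `x` at horizon `n + 1` would then exceed its own limit.
  have hev : ∀ᶠ n in atTop, ∀ y : {y : V // G.Arc x y}, w x < G.minGain σ n y :=
    eventually_all.2 fun y => (hw y).eventually_const_lt (hlt y y.2)
  obtain ⟨n, hn⟩ := hev.exists
  have := G.nonempty_arc hx
  obtain ⟨y, hy⟩ := exists_eq_ciInf_of_finite (f := fun y : {y : V // G.Arc x y} =>
    G.minGain σ n y)
  have h1 := (G.monotone_minGain σ x).ge_of_tendsto (hw x) (n + 1)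
  simp only [minGain_min G σ n hx, ← hy] at h1
  exact absurd (hn y) (not_lt.2 h1)

/-! ### The value `v_σ` as the limit of the finite-horizon gains. -/

variable [MeasurableSpace V] [DiscreteMeasurableSpace V]

lemma minGain_le_value (G : SSG V) (σ : G.PositionalStrategy .max) (τ : G.GeneralStrategy .min)
    (n : ℕ) (x₀ : V) : G.minGain σ n x₀ ≤ G.value σ.toGeneral τ x₀ := by
  refine ge_of_tendsto (G.tendsto_value σ.toGeneral τ x₀) ?_
  filter_upwards [eventually_ge_atTop n] with N hN
  refine (G.monotone_minGain σ x₀ hN).trans ?_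
  -- After `m` of `N` moves the expected gain with `k` moves left has not dropped, whatever Min
  -- does. At `k = 0` it is the expected sink value at time `N`, which tends to the value.
  have hstep : ∀ m k, m + k = N → G.minGain σ N x₀ ≤
      ∫ X, G.minGain σ k (X m) ∂(G.playMeasure σ.toGeneral τ x₀) := by
    intro m
    induction m with
    | zero =>
      intro k hk
      rw [G.integral_eval_zero, ← hk, zero_add]
    | succ m ih =>
      intro k hk
      refine (ih (k + 1) (by omega)).trans (G.integral_eval_mono _ _ x₀ m _ _ fun h => ?_)
      rcases G.kind_cases (lastVertex h) with hx | hx | hx | hx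
      · rw [G.integral_nextMeasure_max _ _ h _ hx, minGain_max G σ k hx]; rfl
      · rw [G.integral_nextMeasure_min _ _ h _ hx]
        exact minGain_succ_le G σ k hx (τ m h hx).2
      · rw [G.integral_nextMeasure_random _ _ h _ hx, minGain_random G σ k hx]
      · rw [G.integral_nextMeasure_sink _ _ h _ hx, minGain_sink G σ _ hx, minGain_sink G σ _ hx]
  exact hstep N 0 rfl

lemma minGain_le_stratValue (G : SSG V) (σ : G.PositionalStrategy .max) (n : ℕ) (x : V) :
    G.minGain σ n x ≤ G.stratValue σ x :=
  G.minGain_le_value σ _ n x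

lemma stratValue_nonneg (G : SSG V) (σ : G.PositionalStrategy .max) (x : V) :
    0 ≤ G.stratValue σ x :=
  (G.minGain_nonneg σ 0 x).trans (G.minGain_le_stratValue σ 0 x)

/-- A nonnegative function that dominates the sink values and that Min can keep from increasing
in expectation is an upper bound of `v_σ`. -/
lemma stratValue_le_of_superharmonic (G : SSG V) (σ : G.PositionalStrategy .max) (f : V → ℝ)
    (hnonneg : ∀ x, 0 ≤ f x) (hsink : ∀ x, G.kind x = .sink → (G.val x : ℝ) ≤ f x)
    (hmax : ∀ x (hx : G.kind x = .max), f (σ ⟨x, hx⟩) ≤ f x)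
    (hmin : ∀ x, G.kind x = .min → ∃ y, G.Arc x y ∧ f y ≤ f x)
    (hrandom : ∀ x, G.kind x = .random → ∑ y, (G.prob x y : ℝ) * f y ≤ f x) (x₀ : V) :
    G.stratValue σ x₀ ≤ f x₀ := by
  choose τ hτ hτf using hmin
  let τ' : G.PositionalStrategy .min := fun x => ⟨τ x x.2, hτ x x.2⟩
  refine ((G.exists_isBestResponse σ).choose_spec τ'.toGeneral x₀).trans ?_
  -- When Min always takes the arc chosen by `hmin`, `f` along the play is a supermartingale;
  -- `integral_eval_mono` is applied to `-f`.
  have hstep : ∀ n, ∫ X, f (X n) ∂(G.playMeasure σ.toGeneral τ'.toGeneral x₀) ≤ f x₀ := by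
    intro n
    induction n with
    | zero => rw [G.integral_eval_zero]
    | succ n ih =>
      refine le_trans ?_ ih
      have := G.integral_eval_mono σ.toGeneral τ'.toGeneral x₀ n
        (fun x => - f x) (fun x => - f x) fun h => ?_
      · simpa [integral_neg] using this
      · rw [integral_neg, neg_le_neg_iff]
        rcases G.kind_cases (lastVertex h) with hx | hx | hx | hx
        · rw [G.integral_nextMeasure_max _ _ h f hx]
          exact hmax _ hx
        · rw [G.integral_nextMeasure_min _ _ h f hx]
          exact hτf _ hx
        · rw [G.integral_nextMeasure_random _ _ h f hx]
          exact hrandom _ hx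
        · rw [G.integral_nextMeasure_sink _ _ h f hx]
  refine le_of_tendsto (G.tendsto_value _ _ x₀) (Eventually.of_forall fun n => ?_)
  refine le_trans (integral_mono (G.integrable_comp_eval _ _ x₀ _ n)
    (G.integrable_comp_eval _ _ x₀ _ n) fun X => ?_) (hstep n)
  -- Plays that have not yet stopped count as 0, which is where nonnegativity of `f` enters.
  simp only [sinkValue]
  split_ifs with hx
  · exact hsink _ hx
  · exact hnonneg _

lemma tendsto_minGain (G : SSG V) (σ : G.PositionalStrategy .max) (x : V) :
    Tendsto (fun n => G.minGain σ n x) atTop (𝓝 (G.stratValue σ x)) := by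
  have hbdd : ∀ x, BddAbove (Set.range fun n => G.minGain σ n x) := fun x =>
    ⟨G.stratValue σ x, by rintro _ ⟨n, rfl⟩; exact G.minGain_le_stratValue σ n x⟩
  let w : V → ℝ := fun x => ⨆ n, G.minGain σ n x
  have hw : ∀ x, Tendsto (fun n => G.minGain σ n x) atTop (𝓝 (w x)) := fun x =>
    tendsto_atTop_ciSup (G.monotone_minGain σ x) (hbdd x)
  have hw_le : ∀ n x, G.minGain σ n x ≤ w x := fun n x => le_ciSup (hbdd x) n
  -- The supremum of the gains inherits superharmonicity from the recursion.
  have hle : ∀ x, G.stratValue σ x ≤ w x := by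
    refine G.stratValue_le_of_superharmonic σ w
      (fun x => (G.minGain_nonneg σ 0 x).trans (hw_le 0 x)) (fun x hx => ?_) (fun x hx => ?_)
      (fun x hx => G.exists_arc_le_of_tendsto_minGain σ hw hx) (fun x hx => ?_)
    · rw [← G.minGain_sink σ 0 hx]
      exact hw_le 0 x
    · refine le_of_tendsto' (hw _) fun n => ?_
      rw [← G.minGain_max σ n hx]
      exact hw_le (n + 1) x
    · refine le_of_tendsto' (tendsto_finsetSum _ fun y _ => (hw y).const_mul _) fun n => ?_
      rw [← G.minGain_random σ n hx]
      exact hw_le (n + 1) x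
  rw [le_antisymm (hle x) (ciSup_le fun n => G.minGain_le_stratValue σ n x)]
  exact hw x

/-! ### Local optimality equations of `v_σ`. -/

lemma stratValue_max (G : SSG V) (σ : G.PositionalStrategy .max) {x : V}
    (hx : G.kind x = .max) : G.stratValue σ x = G.stratValue σ (σ ⟨x, hx⟩) := by
  refine tendsto_nhds_unique ((tendsto_add_atTop_iff_nat 1).2 (G.tendsto_minGain σ x)) ?_
  simp only [G.minGain_max σ _ hx]
  exact G.tendsto_minGain σ _

lemma stratValue_min_le (G : SSG V) (σ : G.PositionalStrategy .max) {x y : V}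
    (hx : G.kind x = .min) (hy : G.Arc x y) : G.stratValue σ x ≤ G.stratValue σ y :=
  le_of_tendsto_of_tendsto' ((tendsto_add_atTop_iff_nat 1).2 (G.tendsto_minGain σ x))
    (G.tendsto_minGain σ y) fun n => G.minGain_succ_le σ n hx hy

lemma exists_stratValue_le (G : SSG V) (σ : G.PositionalStrategy .max) {x : V}
    (hx : G.kind x = .min) : ∃ y, G.Arc x y ∧ G.stratValue σ y ≤ G.stratValue σ x :=
  G.exists_arc_le_of_tendsto_minGain σ (G.tendsto_minGain σ) hx

lemma stratValue_random (G : SSG V) (σ : G.PositionalStrategy .max) {x : V}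
    (hx : G.kind x = .random) :
    G.stratValue σ x = ∑ y, (G.prob x y : ℝ) * G.stratValue σ y := by
  refine tendsto_nhds_unique ((tendsto_add_atTop_iff_nat 1).2 (G.tendsto_minGain σ x)) ?_
  simp only [G.minGain_random σ _ hx]
  exact tendsto_finsetSum _ fun y _ => (G.tendsto_minGain σ y).const_mul _

lemma stratValue_sink (G : SSG V) (σ : G.PositionalStrategy .max) {x : V}
    (hx : G.kind x = .sink) : G.stratValue σ x = G.val x := by
  refine tendsto_nhds_unique (G.tendsto_minGain σ x) ?_
  simp only [G.minGain_sink σ _ hx]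
  exact tendsto_const_nhds

/-! ### Comparison of the values before and after a switch or an anti-switch. -/

/-- If Min can keep the play inside a set without sinks against `σ`, then `v_σ` vanishes there. -/
lemma stratValue_le_zero_of_trap (G : SSG V) (σ : G.PositionalStrategy .max) (C : Set V)
    (hsink : ∀ x ∈ C, G.kind x ≠ .sink)
    (hmax : ∀ x ∈ C, ∀ hx : G.kind x = .max, (σ ⟨x, hx⟩ : V) ∈ C)
    (hmin : ∀ x ∈ C, G.kind x = .min → ∃ y ∈ C, G.Arc x y)
    (hrandom : ∀ x ∈ C, G.kind x = .random → ∀ y, G.Arc x y → y ∈ C) {x₀ : V} (hx₀ : x₀ ∈ C) :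
    G.stratValue σ x₀ ≤ 0 := by
  classical
  -- The indicator of the complement of `C` is superharmonic: it is 0 where Min can stay, and
  -- elsewhere has the largest possible value, 1, which also bounds every sink value.
  let f : V → ℝ := fun x => if x ∈ C then 0 else 1
  have f0 : ∀ x ∈ C, f x = 0 := fun x hx => if_pos hx
  have f1 : ∀ x ∉ C, f x = 1 := fun x hx => if_neg hx
  have fnn : ∀ x, 0 ≤ f x := fun x => by simp only [f]; split_ifs <;> simp
  have fle : ∀ x, f x ≤ 1 := fun x => by simp only [f]; split_ifs <;> simp
  rw [← f0 x₀ hx₀]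
  refine G.stratValue_le_of_superharmonic σ f fnn (fun x hx => ?_) (fun x hx => ?_)
    (fun x hx => ?_) (fun x hx => ?_) x₀
  · rw [f1 x fun h => hsink x h hx]
    exact_mod_cast G.val_le_one x hx
  · by_cases h : x ∈ C
    · rw [f0 _ (hmax x h hx), f0 x h]
    · rw [f1 x h]; exact fle _
  · by_cases h : x ∈ C
    · obtain ⟨y, hy, hxy⟩ := hmin x h hx
      exact ⟨y, hxy, by rw [f0 y hy, f0 x h]⟩
    · obtain ⟨y, hy⟩ := G.nonempty_arc hx
      exact ⟨y, hy, by rw [f1 x h]; exact fle _⟩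
  · by_cases h : x ∈ C
    · rw [f0 x h]
      refine (Finset.sum_eq_zero fun y _ => ?_).le
      by_cases hxy : G.Arc x y
      · rw [f0 y (hrandom x h hx y hxy), mul_zero]
      · have h0 : G.prob x y = 0 := le_antisymm
          (not_lt.1 fun hlt => hxy ((G.prob_pos_iff x hx y).1 hlt)) (G.prob_nonneg x hx y)
        simp [h0]
    · rw [f1 x h, ← G.prob_cast_sum hx]
      exact Finset.sum_le_sum fun y _ =>
        mul_le_of_le_one_right (G.prob_cast_nonneg hx y) (fle y)

lemma IsSwitch.stratValue_le {G : SSG V} {σ σ' : G.PositionalStrategy .max}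
    {S : Set {x : V // G.kind x = .max}} (h : G.IsSwitch σ σ' S) (x : V) :
    G.stratValue σ x ≤ G.stratValue σ' x := by
  -- The set `C` where `v_σ - v_σ'` is maximal is a trap for `σ` if the maximum is positive.
  let d : V → ℝ := fun x => G.stratValue σ x - G.stratValue σ' x
  have : Nonempty V := ⟨x⟩
  obtain ⟨m, hm⟩ := Finite.exists_max d
  by_contra! hlt
  have hpos : 0 < d m := (sub_pos.2 hlt).trans_le (hm x)
  let C : Set V := {x | d x = d m}
  have hC : ∀ {y}, d m ≤ d y → y ∈ C := fun {y} hy => le_antisymm (hm y) hy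
  have key : G.stratValue σ m ≤ 0 := by
    refine G.stratValue_le_zero_of_trap σ C (fun y hy hk => ?_) (fun y hy hk => ?_)
      (fun y hy hk => ?_) (fun y hy hk z hz => ?_) (show m ∈ C from rfl)
    · have hy : d y = d m := hy
      simp only [d, G.stratValue_sink _ hk, sub_self] at hy
      exact hpos.ne (by simpa only [d] using hy)
    · have hy : d y = d m := hy
      -- A switched vertex cannot lie in `C`: moving along `σ'` raises `v_σ` and keeps `v_σ'`, so
      -- `d` would exceed its maximum.
      by_cases hyS : (⟨y, hk⟩ : {x : V // G.kind x = .max}) ∈ S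
      · have h1 := h.2 _ hyS
        rw [← G.stratValue_max σ hk] at h1
        have h2 := G.stratValue_max σ' hk
        have h3 := hm (σ' ⟨y, hk⟩)
        rw [← hy] at h3
        simp only [d] at h3
        linarith
      · apply hC
        rw [← hy]
        have h2 := G.stratValue_max σ' hk
        rw [h.1 _ hyS] at h2
        simp only [d]
        rw [← h2, ← G.stratValue_max σ hk]
    · have hy : d y = d m := hy
      -- The arc is chosen optimal against `σ'`, not `σ`: `v_σ'` does not increase along it, while
      -- `v_σ` does not decrease along any arc of a min vertex, so `d` does not decrease.
      obtain ⟨z, hz, hle⟩ := G.exists_stratValue_le σ' hk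
      refine ⟨z, hC ?_, hz⟩
      rw [← hy]
      exact sub_le_sub (G.stratValue_min_le σ hk hz) hle
    · have hy : d y = d m := hy
      -- The maximum of `d` is attained as an average, so every outneighbour, having positive
      -- probability, attains it.
      have hsum : ∑ u, (G.prob y u : ℝ) * d u = ∑ u, (G.prob y u : ℝ) * d m := by
        rw [← Finset.sum_mul, G.prob_cast_sum hk, one_mul, ← hy]
        simp only [d, mul_sub, Finset.sum_sub_distrib, ← G.stratValue_random _ hk]
      have hterm := (Finset.sum_eq_sum_iff_of_le fun u _ =>
        mul_le_mul_of_nonneg_left (hm u) (G.prob_cast_nonneg hk u)).1 hsum z (Finset.mem_univ z)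
      have hp : (0 : ℝ) < G.prob y z := by exact_mod_cast (G.prob_pos_iff y hk z).2 hz
      exact mul_left_cancel₀ hp.ne' hterm
  have := G.stratValue_nonneg σ' m
  simp only [d] at hpos
  linarith

/-- Here `v_σ` itself is the superharmonic bound for `σ'`; only the max vertices need checking, as
the other conditions do not involve the strategy of Max. -/
lemma IsAntiSwitch.stratValue_le {G : SSG V} {σ σ' : G.PositionalStrategy .max}
    {S : Set {x : V // G.kind x = .max}} (h : G.IsAntiSwitch σ σ' S) (x : V) :
    G.stratValue σ' x ≤ G.stratValue σ x := by
  refine G.stratValue_le_of_superharmonic σ' (G.stratValue σ) (G.stratValue_nonneg σ)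
    (fun y hy => (G.stratValue_sink σ hy).ge) (fun y hy => ?_)
    (fun y hy => G.exists_stratValue_le σ hy) (fun y hy => (G.stratValue_random σ hy).ge) x
  rw [G.stratValue_max σ hy]
  by_cases hyS : (⟨y, hy⟩ : {x : V // G.kind x = .max}) ∈ S
  · exact (h.2 _ hyS).le
  · rw [h.1 _ hyS]

end

end SSG

theorem mainTheorem9 {V : Type*} [Fintype V] [MeasurableSpace V] [DiscreteMeasurableSpace V]
    (G : SSG V) (σ σ' : G.PositionalStrategy .max) (S : Set {x : V // G.kind x = .max})
    (hS : S.Nonempty) :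
    (G.IsSwitch σ σ' S → G.StrictlyBetter σ' σ) ∧
      (G.IsAntiSwitch σ σ' S → G.StrictlyBetter σ σ') := by
  obtain ⟨x, hx⟩ := hS
  refine ⟨fun h => ⟨h.stratValue_le, x, ?_⟩, fun h => ⟨h.stratValue_le, x, ?_⟩⟩
  -- At a switched `x`: `v_σ(σ x) < v_σ(σ' x) ≤ v_σ'(σ' x)`, whose ends are `v_σ(x)` and `v_σ'(x)`.
  · rw [G.stratValue_max σ x.2, G.stratValue_max σ' x.2]
    exact (h.2 x hx).trans_le (h.stratValue_le _)
  · rw [G.stratValue_max σ x.2, G.stratValue_max σ' x.2]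
    exact (h.stratValue_le _).trans_lt (h.2 x hx)
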